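/- Let $a=(a_k)_{k\ge 0}$ and $c=(c_k)_{k\ge 0}$ be real $2$-periodic sequences (that is, $a_{k+2}=a_k$ and $c_{k+2}=c_k$ for all $k\ge 0$) and let $b$ be the constant $0$ sequence. Let $T(a,b,c)$ be the bounded operator on the complex Hilbert space $\ell^2(\mathbb N_0)$ given by the tridiagonal matrix whose row $k$ has the entries $a_k$, $b_k$, $c_k$ in columns $k-1$, $k$, $k+1$ (for $k=0$ only $b_0$, $c_0$ in columns $0$, $1$). For a bounded operator $A$ on a complex Hilbert space put $W(A)=\{\langle Ax,x\rangle : \|x\|=1\}$; square complex matrices are regarded as operators on $\mathbb C^m$ with the Euclidean inner product. Set \[ \alpha_0=\frac{c_0+\overline{a_1}}{2},\quad \gamma_0=\frac{c_0-\overline{a_1}}{2i},\quad \alpha_1=\frac{a_0+\overline{c_1}}{2},\quad \gamma_1=\frac{a_0-\overline{c_1}}{2i} \] and \[ S=\begin{pmatrix} \alpha_0+\alpha_1 & -\gamma_0 & -\gamma_1 & 0\\ -\gamma_0 & -\alpha_0+\alpha_1 & 0 & -\gamma_1\\ -\gamma_1 & 0 & \alpha_0-\alpha_1 & -\gamma_0\\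 0 & -\gamma_1 & -\gamma_0 & -\alpha_0-\alpha_1 \end{pmatrix}. \] Then $\overline{W(T(a,b,c))}=W(S)$. -/

import Mathlib

open scoped ComplexConjugate ENNReal

/-- The Hilbert space `ℓ²(ℕ₀)` of square-summable complex sequences. -/
abbrev Ell2 : Type := lp (fun _ : ℕ => ℂ) 2

/-- The numerical range `W(A) = {⟨A x, x⟩ : ‖x‖ = 1}` of a bounded operator on a complex inner
product space. The bracket `⟨u, v⟩`, linear in `u`, is Mathlib's `inner ℂ v u`. -/
def numericalRange {H : Type*} [NormedAddCommGroup H] [InnerProductSpace ℂ H]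
    (A : H →L[ℂ] H) : Set ℂ :=
  {z | ∃ x : H, ‖x‖ = 1 ∧ inner ℂ x (A x) = z}

/-- The numerical range of a square complex matrix, acting on `ℂᵐ` with the Euclidean norm. -/
noncomputable def matrixNumericalRange {m : ℕ} (A : Matrix (Fin m) (Fin m) ℂ) : Set ℂ :=
  numericalRange (Matrix.toEuclideanCLM (n := Fin m) (𝕜 := ℂ) A)

/-- The formal action of the infinite tridiagonal matrix whose row `k` has the entries
`a k`, `b k`, `c k` in the columns `k - 1`, `k`, `k + 1` (row `0` has no entry `a 0`). -/
def tridiagAct (a b c : ℕ → ℂ) (x : ℕ → ℂ) : ℕ → ℂ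
  | 0 => b 0 * x 0 + c 0 * x 1
  | k + 1 => a (k + 1) * x k + b (k + 1) * x (k + 1) + c (k + 1) * x (k + 2)

theorem periodic_norm_le {a : ℕ → ℂ} {n : ℕ} (ha : Function.Periodic a (n + 1)) :
    ∃ M : ℝ, ∀ k, ‖a k‖ ≤ M := by
  refine ⟨∑ i ∈ Finset.range (n + 1), ‖a i‖, fun k => ?_⟩
  rw [← ha.map_mod_nat k]
  exact Finset.single_le_sum (f := fun i => ‖a i‖) (fun i _ => norm_nonneg _)
    (Finset.mem_range.2 (Nat.mod_lt _ n.succ_pos))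

theorem memlp_two_iff (u : ℕ → ℂ) :
    Memℓp u 2 ↔ Summable fun k => ‖u k‖ ^ 2 := by
  rw [memℓp_gen_iff (by norm_num)]
  norm_num

theorem memlp_mul_of_bounded {w u : ℕ → ℂ} (hw : ∃ M : ℝ, ∀ k, ‖w k‖ ≤ M)
    (hu : Memℓp u 2) : Memℓp (fun k => w k * u k) 2 := by
  obtain ⟨M, hM⟩ := hw
  rw [memlp_two_iff] at hu ⊢
  refine Summable.of_nonneg_of_le (fun k => by positivity) (fun k => ?_) (hu.mul_left (M ^ 2))
  rw [norm_mul, mul_pow]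
  gcongr
  exact hM k

theorem memlp_tridiagAct {a b c : ℕ → ℂ} {n : ℕ} (ha : Function.Periodic a (n + 1))
    (hb : Function.Periodic b (n + 1)) (hc : Function.Periodic c (n + 1)) (x : Ell2) :
    Memℓp (tridiagAct a b c x) 2 := by
  have hx : Memℓp (fun k => x k) 2 := lp.memℓp x
  have hs := (memlp_two_iff _).1 hx
  have hup : Memℓp (fun k => x (k + 1)) 2 :=
    (memlp_two_iff _).2 ((summable_nat_add_iff 1).2 hs)
  have hdown : Memℓp (fun k => if k = 0 then (0 : ℂ) else x (k - 1)) 2 :=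
    (memlp_two_iff _).2 ((summable_nat_add_iff 1).1 (by simpa using hs))
  have h := ((memlp_mul_of_bounded (periodic_norm_le ha) hdown).add
    (memlp_mul_of_bounded (periodic_norm_le hb) hx)).add
    (memlp_mul_of_bounded (periodic_norm_le hc) hup)
  convert h using 1
  funext k
  cases k <;> simp [tridiagAct]

/-- The tridiagonal operator with periodic entries, as a linear map of `ℓ²(ℕ₀)`. -/
def tridiagLin {n : ℕ} {a b c : ℕ → ℂ} (ha : Function.Periodic a (n + 1))
    (hb : Function.Periodic b (n + 1)) (hc : Function.Periodic c (n + 1)) : Ell2 →ₗ[ℂ] Ell2 where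
  toFun x := ⟨tridiagAct a b c x, memlp_tridiagAct ha hb hc x⟩
  map_add' x y := by
    ext k
    change tridiagAct a b c (x + y : Ell2) k = tridiagAct a b c x k + tridiagAct a b c y k
    cases k <;> simp [tridiagAct] <;> ring
  map_smul' r x := by
    ext k
    cases k <;> simp [tridiagAct] <;> ring

theorem tridiagLin_apply {n : ℕ} {a b c : ℕ → ℂ} (ha : Function.Periodic a (n + 1))
    (hb : Function.Periodic b (n + 1)) (hc : Function.Periodic c (n + 1)) (x : Ell2) (k : ℕ) :
    tridiagLin ha hb hc x k = tridiagAct a b c x k := rfl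

theorem continuous_tridiagLin {n : ℕ} {a b c : ℕ → ℂ} (ha : Function.Periodic a (n + 1))
    (hb : Function.Periodic b (n + 1)) (hc : Function.Periodic c (n + 1)) :
    Continuous (tridiagLin ha hb hc) := by
  refine LinearMap.continuous_of_seq_closed_graph _ fun u x y hu hTu => ?_
  have coord : ∀ k, Continuous fun z : Ell2 => z k := fun k =>
    (lp.evalCLM ℂ (fun _ : ℕ => ℂ) 2 k).continuous
  ext k
  have hx : ∀ j, Filter.Tendsto (fun i => u i j) Filter.atTop (nhds (x j)) := fun j =>
    ((coord j).tendsto x).comp hu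
  have hy : Filter.Tendsto (fun i => tridiagAct a b c (u i) k) Filter.atTop (nhds (y k)) :=
    ((coord k).tendsto y).comp hTu
  refine tendsto_nhds_unique hy ?_
  rw [tridiagLin_apply]
  cases k with
  | zero => exact ((hx 0).const_mul _).add ((hx 1).const_mul _)
  | succ k =>
    exact (((hx k).const_mul _).add ((hx (k + 1)).const_mul _)).add ((hx (k + 2)).const_mul _)

/-- The `(n + 1)`-periodic tridiagonal operator `T(a, b, c)`, as a bounded operator on `ℓ²(ℕ₀)`. -/
def tridiagOp {n : ℕ} {a b c : ℕ → ℂ} (ha : Function.Periodic a (n + 1))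
    (hb : Function.Periodic b (n + 1)) (hc : Function.Periodic c (n + 1)) : Ell2 →L[ℂ] Ell2 where
  toLinearMap := tridiagLin ha hb hc
  cont := continuous_tridiagLin ha hb hc

/-- `α_j = (c_j + conj a_{j+1}) / 2` for `j < n`, and `α_n = (a_0 + conj c_n) / 2`. -/
noncomputable def alphaCoeff (n : ℕ) (a c : ℕ → ℂ) (j : ℕ) : ℂ :=
  if j < n then (c j + conj (a (j + 1))) / 2 else (a 0 + conj (c n)) / 2

/-- `γ_j = (c_j - conj a_{j+1}) / (2i)` for `j < n`, and `γ_n = (a_0 - conj c_n) / (2i)`. -/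
noncomputable def gammaCoeff (n : ℕ) (a c : ℕ → ℂ) (j : ℕ) : ℂ :=
  if j < n then (c j - conj (a (j + 1))) / (2 * Complex.I)
  else (a 0 - conj (c n)) / (2 * Complex.I)

/-- The explicit `4 × 4` matrix `S` with entries built from `α₀, α₁, γ₀, γ₁`. -/
def matrixS (α₀ α₁ γ₀ γ₁ : ℂ) : Matrix (Fin 4) (Fin 4) ℂ :=
  !![α₀ + α₁, -γ₀, -γ₁, 0;
     -γ₀, -α₀ + α₁, 0, -γ₁;
     -γ₁, 0, α₀ - α₁, -γ₀;
     0, -γ₁, -γ₀, -α₀ - α₁]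

/-
Idea. Put `E(c, a) = {c s + a s̄ : |s| ≤ 1/2}`, an elliptical disc. Both sides are the Minkowski sum
`E(c₀, a₁) + E(c₁, a₀)`.

For `S`, which is a Kronecker sum of two `2 × 2` blocks, the form `⟨S x, x⟩` splits into one
elliptic map per block, and tensor products of vectors reach every pair of arguments. For `T`,
`⟨T x, x⟩` is the sum over `k` of `c_k w_k + a_{k+1} w̄_k` with `w_k = x̄_k x_{k+1}`, so by
periodicity it only depends on the sum of the `w_k` with `k` even and that with `k` odd; each has
modulus at most `1/2` because the pairs `{k, k + 1}` with `k` of fixed parity are disjoint.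
Conversely, normalized truncations of unimodular sequences with `4`-periodic ratios produce averages
of two points of each ellipse, hence in the limit all points of both discs.
-/

open Complex Filter Metric Set
open scoped Pointwise Topology

section Scalars

variable {𝕜 : Type*} [RCLike 𝕜]

theorem norm_conj_mul_le (u v : 𝕜) : ‖conj u * v‖ ≤ (‖u‖ ^ 2 + ‖v‖ ^ 2) / 2 := by
  rw [norm_mul, RCLike.norm_conj]
  linarith [two_mul_le_add_sq ‖u‖ ‖v‖]

theorem exists_conj_mul_eq {p : 𝕜} {r : ℝ} (hp : ‖p‖ ≤ r / 2) :
    ∃ u v : 𝕜, conj u * v = p ∧ ‖u‖ ^ 2 + ‖v‖ ^ 2 = r := by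
  obtain ⟨ω, hω, hωp⟩ := RCLike.exists_norm_mul_eq_self p
  have hadd : √(r + 2 * ‖p‖) ^ 2 = r + 2 * ‖p‖ := Real.sq_sqrt (by linarith [norm_nonneg p])
  have hsub : √(r - 2 * ‖p‖) ^ 2 = r - 2 * ‖p‖ := Real.sq_sqrt (by linarith)
  set A := √(r + 2 * ‖p‖)
  set B := √(r - 2 * ‖p‖)
  refine ⟨((A + B) / 2 : ℝ), ω * ((A - B) / 2 : ℝ), ?_, ?_⟩
  · have hAB : (A + B) / 2 * ((A - B) / 2) = ‖p‖ := by linear_combination (hadd - hsub) / 4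
    rw [RCLike.conj_ofReal, mul_left_comm, ← RCLike.ofReal_mul, hAB, hωp]
  · rw [norm_mul, hω, one_mul, RCLike.norm_ofReal, RCLike.norm_ofReal, sq_abs, sq_abs]
    linear_combination (hadd + hsub) / 2

end Scalars

theorem exists_norm_eq_add_eq {p : ℂ} {r : ℝ} (hp : ‖p‖ ≤ 2 * r) :
    ∃ ζ η : ℂ, ‖ζ‖ = r ∧ ‖η‖ = r ∧ ζ + η = p := by
  obtain ⟨ω, hω, hωp⟩ := RCLike.exists_norm_mul_eq_self p
  have hr : ‖p‖ / 2 ≤ r := by linarith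
  have hr_nonneg : 0 ≤ r := (by positivity : 0 ≤ ‖p‖ / 2).trans hr
  have hnorm (t : ℝ) (ht : t ^ 2 = r ^ 2 - (‖p‖ / 2) ^ 2) :
      ‖ω * ((‖p‖ / 2 : ℝ) + t * I)‖ = r := by
    rw [norm_mul, hω, one_mul, norm_add_mul_I, ht, add_sub_cancel, Real.sqrt_sq hr_nonneg]
  have ht : √(r ^ 2 - (‖p‖ / 2) ^ 2) ^ 2 = r ^ 2 - (‖p‖ / 2) ^ 2 :=
    Real.sq_sqrt (sub_nonneg.2 (by gcongr))
  refine ⟨_, _, hnorm _ ht, hnorm (-√(r ^ 2 - (‖p‖ / 2) ^ 2)) (by rwa [neg_sq]), ?_⟩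
  push_cast
  linear_combination hωp

section Elliptic

/-- The real-linear map `s ↦ c s + a s̄` of the plane; it is the form `⟨A x, x⟩` of the matrix `A`
with rows `(0, c)`, `(a, 0)`, written in terms of `s = x̄₀ x₁`. -/
noncomputable def ellipticMap (c a : ℂ) : ℂ →L[ℝ] ℂ :=
  c • ContinuousLinearMap.id ℝ ℂ + a • (conjCLE : ℂ →L[ℝ] ℂ)

/-- The (possibly degenerate) closed elliptical disc with foci `±√(c a)` and major axis of length
`|c| + |a|`. The radius `1/2` is the maximum of `|x̄₀ x₁|` over unit vectors `x`. -/
def ellipticDisc (c a : ℂ) : Set ℂ := ellipticMap c a '' closedBall 0 (1 / 2)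

theorem ellipticMap_apply (c a s : ℂ) : ellipticMap c a s = c * s + a * conj s := by
  simp [ellipticMap]

theorem isCompact_ellipticDisc (c a : ℂ) : IsCompact (ellipticDisc c a) :=
  (isCompact_closedBall 0 (1 / 2)).image (ellipticMap c a).continuous

theorem ellipticMap_mem_ellipticDisc (c a : ℂ) {s : ℂ} (hs : ‖s‖ ≤ 1 / 2) :
    ellipticMap c a s ∈ ellipticDisc c a :=
  mem_image_of_mem _ (mem_closedBall_zero_iff.2 hs)

theorem ellipticDisc_comm (c a : ℂ) : ellipticDisc c a = ellipticDisc a c := by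
  suffices h : ∀ c a, ellipticDisc c a ⊆ ellipticDisc a c from (h c a).antisymm (h a c)
  rintro c a _ ⟨s, hs, rfl⟩
  refine ⟨conj s, by simpa using hs, ?_⟩
  rw [ellipticMap_apply, ellipticMap_apply, conj_conj, add_comm]

end Elliptic

section Matrix

/-- The point `((|y|² - |z|²) + 2 i Re(ȳ z)) / 2`, half of the projection to a plane of the Bloch
vector of `(y, z)`. It is written as the product of the coordinates of `(y, z)` in the basis that
makes the `2 × 2` blocks of `matrixS` off-diagonal. -/
noncomputable def blochPoint (y z : ℂ) : ℂ := conj (y - I * z) * (y + I * z) / 2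

theorem norm_sub_I_mul_sq_add (y z : ℂ) :
    ‖y - I * z‖ ^ 2 + ‖y + I * z‖ ^ 2 = 2 * (‖y‖ ^ 2 + ‖z‖ ^ 2) := by
  have h := parallelogram_law_with_norm ℂ y (I * z)
  rw [norm_mul, norm_I, one_mul] at h
  linarith

theorem norm_blochPoint_le (y z : ℂ) : ‖blochPoint y z‖ ≤ (‖y‖ ^ 2 + ‖z‖ ^ 2) / 2 := by
  rw [blochPoint, norm_div, Complex.norm_two]
  linarith [norm_conj_mul_le (y - I * z) (y + I * z), norm_sub_I_mul_sq_add y z]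

theorem norm_blochPoint_add_le (y z y' z' : ℂ) :
    ‖blochPoint y z + blochPoint y' z'‖ ≤ (‖y‖ ^ 2 + ‖z‖ ^ 2 + ‖y'‖ ^ 2 + ‖z'‖ ^ 2) / 2 := by
  linarith [norm_add_le (blochPoint y z) (blochPoint y' z'), norm_blochPoint_le y z,
    norm_blochPoint_le y' z']

theorem exists_blochPoint_eq {p : ℂ} {r : ℝ} (hp : ‖p‖ ≤ r / 2) :
    ∃ y z : ℂ, blochPoint y z = p ∧ ‖y‖ ^ 2 + ‖z‖ ^ 2 = r := by
  obtain ⟨u, v, huv, hr⟩ := exists_conj_mul_eq (p := 2 * p) (r := 2 * r)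
    (by rw [norm_mul, Complex.norm_two]; linarith)
  have hu : (u + v) / 2 - I * (I * (u - v) / 2) = u := by linear_combination -(u - v) / 2 * I_sq
  have hv : (u + v) / 2 + I * (I * (u - v) / 2) = v := by linear_combination (u - v) / 2 * I_sq
  refine ⟨(u + v) / 2, I * (u - v) / 2, ?_, ?_⟩
  · rw [blochPoint, hu, hv, huv, mul_div_cancel_left₀ _ two_ne_zero]
  · have h := norm_sub_I_mul_sq_add ((u + v) / 2) (I * (u - v) / 2)
    rw [hu, hv, hr] at h
    linarith

theorem blochPoint_mul_mul (w y z : ℂ) :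
    blochPoint (w * y) (w * z) = (‖w‖ ^ 2 : ℝ) * blochPoint y z := by
  rw [ofReal_pow, ← conj_mul', blochPoint, blochPoint, mul_left_comm I w z, ← mul_sub, ← mul_add,
    map_mul]
  ring

theorem blochPoint_mul_mul' (w y z : ℂ) :
    blochPoint (y * w) (z * w) = (‖w‖ ^ 2 : ℝ) * blochPoint y z := by
  rw [mul_comm y, mul_comm z, blochPoint_mul_mul]

theorem inner_matrixS (α₀ α₁ γ₀ γ₁ : ℂ) (x : EuclideanSpace ℂ (Fin 4)) :
    inner ℂ x (Matrix.toEuclideanCLM (n := Fin 4) (𝕜 := ℂ) (matrixS α₀ α₁ γ₀ γ₁) x) =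
      ellipticMap (α₀ + I * γ₀) (α₀ - I * γ₀) (blochPoint (x 0) (x 1) + blochPoint (x 2) (x 3)) +
      ellipticMap (α₁ + I * γ₁) (α₁ - I * γ₁)
        (blochPoint (x 0) (x 2) + blochPoint (x 1) (x 3)) := by
  have hbloch (α γ y z : ℂ) : ellipticMap (α + I * γ) (α - I * γ) (blochPoint y z) =
      α * (conj y * y - conj z * z) - γ * (conj y * z + conj z * y) := by
    simp only [ellipticMap_apply, blochPoint, map_div₀, map_mul, map_sub, map_add, map_neg,
      conj_I, conj_conj, conj_ofNat]
    linear_combination (α * conj z * z + γ * (conj y * z + conj z * y)) * I_sq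
  rw [PiLp.inner_apply, map_add, map_add]
  simp only [hbloch, Matrix.ofLp_toEuclideanCLM, Fin.sum_univ_four, RCLike.inner_apply, matrixS,
    Matrix.mulVec, dotProduct, Matrix.of_apply, Matrix.cons_val]
  ring

theorem matrixNumericalRange_matrixS (α₀ α₁ γ₀ γ₁ : ℂ) :
    matrixNumericalRange (matrixS α₀ α₁ γ₀ γ₁) =
      ellipticDisc (α₀ + I * γ₀) (α₀ - I * γ₀) + ellipticDisc (α₁ + I * γ₁) (α₁ - I * γ₁) := by
  apply Subset.antisymm
  · rintro _ ⟨x, hx, rfl⟩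
    have hsum : ‖x 0‖ ^ 2 + ‖x 1‖ ^ 2 + ‖x 2‖ ^ 2 + ‖x 3‖ ^ 2 = 1 := by
      rw [← Fin.sum_univ_four (fun i => ‖x i‖ ^ 2), ← EuclideanSpace.norm_sq_eq, hx, one_pow]
    rw [inner_matrixS]
    apply Set.add_mem_add <;> apply ellipticMap_mem_ellipticDisc
    · linarith [norm_blochPoint_add_le (x 0) (x 1) (x 2) (x 3)]
    · linarith [norm_blochPoint_add_le (x 0) (x 2) (x 1) (x 3)]
  · rintro _ ⟨_, ⟨p, hp, rfl⟩, _, ⟨q, hq, rfl⟩, rfl⟩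
    obtain ⟨y₀, y₁, rfl, hy⟩ := exists_blochPoint_eq (mem_closedBall_zero_iff.1 hp)
    obtain ⟨z₀, z₁, rfl, hz⟩ := exists_blochPoint_eq (mem_closedBall_zero_iff.1 hq)
    refine ⟨!₂[z₀ * y₀, z₀ * y₁, z₁ * y₀, z₁ * y₁], ?_, ?_⟩
    · rw [← sq_eq_sq₀ (norm_nonneg _) zero_le_one, EuclideanSpace.norm_sq_eq, Fin.sum_univ_four]
      simp only [Matrix.cons_val, norm_mul]
      linear_combination (‖y₀‖ ^ 2 + ‖y₁‖ ^ 2) * hz + hy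
    · rw [inner_matrixS]
      simp only [Matrix.cons_val, blochPoint_mul_mul, blochPoint_mul_mul']
      rw [← add_mul, ← add_mul, ← ofReal_add, ← ofReal_add, hy, hz, ofReal_one, one_mul, one_mul]

end Matrix

section Operator

theorem summable_mul_of_norm_le {ι R : Type*} [NormedRing R] [CompleteSpace R] {w u : ι → R}
    (hw : ∃ M : ℝ, ∀ k, ‖w k‖ ≤ M) (hu : Summable fun k => ‖u k‖) :
    Summable fun k => w k * u k := by
  obtain ⟨M, hM⟩ := hw
  refine Summable.of_norm_bounded (hu.mul_left M) fun k => (norm_mul_le _ _).trans ?_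
  gcongr
  exact hM k

section SquareSummable

variable {ι κ 𝕜 : Type*} [RCLike 𝕜]

theorem lp_two_hasSum_norm_sq (x : lp (fun _ : κ => 𝕜) 2) :
    HasSum (fun k => ‖x k‖ ^ 2) (‖x‖ ^ 2) := by
  simpa using lp.hasSum_norm (p := 2) (by norm_num) x

theorem summable_norm_conj_mul (x : lp (fun _ : κ => 𝕜) 2) {i j : ι → κ}
    (hi : i.Injective) (hj : j.Injective) : Summable fun k => ‖conj (x (i k)) * x (j k)‖ := by
  have hx := (lp_two_hasSum_norm_sq x).summable
  exact .of_nonneg_of_le (fun _ => norm_nonneg _)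
    (fun k => norm_conj_mul_le (x (i k)) (x (j k)))
    (((hx.comp_injective hi).add (hx.comp_injective hj)).div_const 2)

theorem norm_tsum_conj_mul_le (x : lp (fun _ : κ => 𝕜) 2) {i j : ι → κ}
    (hij : (Sum.elim i j).Injective) : ‖∑' k, conj (x (i k)) * x (j k)‖ ≤ ‖x‖ ^ 2 / 2 := by
  let f : κ → ℝ := fun k => ‖x k‖ ^ 2
  have hf : HasSum f (‖x‖ ^ 2) := lp_two_hasSum_norm_sq x
  have hi : HasSum (fun k => f (i k)) (∑' k, f (i k)) :=
    (hf.summable.comp_injective (hij.comp Sum.inl_injective)).hasSum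
  have hj : HasSum (fun k => f (j k)) (∑' k, f (j k)) :=
    (hf.summable.comp_injective (hij.comp Sum.inr_injective)).hasSum
  have hpairs : ‖∑' k, conj (x (i k)) * x (j k)‖ ≤ (∑' k, f (i k) + ∑' k, f (j k)) / 2 :=
    tsum_of_norm_bounded ((hi.add hj).div_const 2) fun k => norm_conj_mul_le (x (i k)) (x (j k))
  have hdisjoint : ∑' k, f (i k) + ∑' k, f (j k) ≤ ‖x‖ ^ 2 :=
    calc ∑' k, f (i k) + ∑' k, f (j k) = ∑' k, (f ∘ Sum.elim i j) k :=
          (HasSum.sum (f := f ∘ Sum.elim i j) hi hj).tsum_eq.symm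
      _ ≤ ∑' k, f k := tsum_comp_le_tsum_of_inj hf.summable (fun k => sq_nonneg ‖x k‖) hij
      _ = ‖x‖ ^ 2 := hf.tsum_eq
  linarith

end SquareSummable

theorem apply_two_mul_add {β : Type*} {f : ℕ → β} (hf : Function.Periodic f 2) (k i : ℕ) :
    f (2 * k + i) = f i := by
  rw [add_comm, mul_comm]
  exact hf.nat_mul k i

theorem sum_range_mul_of_periodic {M : Type*} [AddCommMonoid M] {f : ℕ → M} {m : ℕ}
    (hf : Function.Periodic f m) (N : ℕ) :
    ∑ k ∈ Finset.range (N * m), f k = N • ∑ k ∈ Finset.range m, f k := by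
  induction N with
  | zero => simp
  | succ N ih =>
    have hblock (k : ℕ) : f (N * m + k) = f k := by
      rw [add_comm]
      exact hf.nat_mul N k
    rw [add_mul, one_mul, Finset.sum_range_add, ih, Finset.sum_congr rfl fun k _ => hblock k,
      succ_nsmul]

theorem exists_unimodular_conj_mul_succ_eq {𝕜 : Type*} [RCLike 𝕜] {s : ℕ → 𝕜}
    (hs : ∀ k, ‖s k‖ = 1) : ∃ u : ℕ → 𝕜, ∀ k, ‖u k‖ = 1 ∧ conj (u k) * u (k + 1) = s k := by
  have hu (k : ℕ) : ‖∏ j ∈ Finset.range k, s j‖ = 1 := by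
    rw [norm_prod, Finset.prod_congr rfl fun j _ => hs j, Finset.prod_const_one]
  refine ⟨fun k => ∏ j ∈ Finset.range k, s j, fun k => ⟨hu k, ?_⟩⟩
  beta_reduce
  rw [Finset.prod_range_succ, ← mul_assoc, RCLike.conj_mul, hu, RCLike.ofReal_one, one_pow,
    one_mul]

theorem exists_norm_eq_one_conj_mul_succ_eq {s : ℕ → ℂ} (hs : ∀ k, ‖s k‖ = 1) (N : ℕ) :
    ∃ x : Ell2, ‖x‖ = 1 ∧
      ∀ k, conj (x k) * x (k + 1) = if k < N then ((N : ℝ) + 1)⁻¹ • s k else 0 := by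
  obtain ⟨u, hu⟩ := exists_unimodular_conj_mul_succ_eq hs
  let r : ℝ := (√((N : ℝ) + 1))⁻¹
  have hr : r ^ 2 = ((N : ℝ) + 1)⁻¹ := by rw [inv_pow, Real.sq_sqrt (by positivity)]
  let x : Ell2 := ∑ k ∈ Finset.range (N + 1), lp.single 2 k (r • u k)
  have hx (k : ℕ) : x k = if k < N + 1 then r • u k else 0 := by
    simp only [x, lp.coeFn_sum, lp.coeFn_single, Finset.sum_apply, Finset.sum_pi_single,
      Finset.mem_range]
  refine ⟨x, ?_, fun k => ?_⟩
  · have hnorm := lp.norm_sum_single (p := 2) (by norm_num) (fun k => r • u k)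
      (Finset.range (N + 1))
    have hsq : ‖x‖ ^ 2 = 1 := by
      simpa [fun k => (hu k).1, norm_smul, hr, x,
        mul_inv_cancel₀ (Nat.cast_add_one_ne_zero (R := ℝ) N)] using hnorm
    exact (pow_eq_one_iff_of_nonneg (norm_nonneg _) two_ne_zero).1 hsq
  · rcases lt_or_ge k N with hk | hk
    · rw [hx, hx, if_pos (by omega), if_pos (by omega), if_pos hk, ← hr, ← (hu k).2]
      simp only [real_smul, map_mul, conj_ofReal, ofReal_pow]
      ring
    · rw [hx (k + 1), if_neg (by omega), if_neg (by omega), mul_zero]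

section TridiagonalForm

variable {n : ℕ} {a b c : ℕ → ℂ} (ha : Function.Periodic a (n + 1))
  (hb : Function.Periodic b (n + 1)) (hc : Function.Periodic c (n + 1))

theorem hasSum_inner_tridiagOp (x : Ell2) :
    HasSum (fun k => b k * (conj (x k) * x k) +
        ellipticMap (c k) (a (k + 1)) (conj (x k) * x (k + 1)))
      (inner ℂ x (tridiagOp ha hb hc x)) := by
  have hw : Summable fun k => ‖conj (x k) * x (k + 1)‖ :=
    summable_norm_conj_mul x Function.injective_id (add_left_injective 1)
  have hw_conj : Summable fun k => ‖conj (conj (x k) * x (k + 1))‖ := by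
    simpa only [RCLike.norm_conj] using hw
  have hdiag : Summable fun k => b k * (conj (x k) * x k) :=
    summable_mul_of_norm_le (periodic_norm_le hb)
      (summable_norm_conj_mul x Function.injective_id Function.injective_id)
  have hupper : Summable fun k => c k * (conj (x k) * x (k + 1)) :=
    summable_mul_of_norm_le (periodic_norm_le hc) hw
  have hlower : Summable fun k => a (k + 1) * conj (conj (x k) * x (k + 1)) :=
    summable_mul_of_norm_le ((periodic_norm_le ha).imp fun _ hM k => hM _) hw_conj
  -- The entries below the diagonal sit one row lower than in the sum over `k`.
  let g : ℕ → ℂ := fun k => k.casesOn 0 fun k => a (k + 1) * conj (conj (x k) * x (k + 1))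
  have hg : HasSum g (∑' k, a (k + 1) * conj (conj (x k) * x (k + 1))) := by
    rw [← hasSum_nat_add_iff' 1]
    simpa [g] using hlower.hasSum
  have hrows (k : ℕ) : inner ℂ (x k) (tridiagOp ha hb hc x k) =
      b k * (conj (x k) * x k) + (c k * (conj (x k) * x (k + 1)) + g k) := by
    change inner ℂ (x k) (tridiagAct a b c x k) = _
    cases k with
    | zero =>
      have hg_zero : g 0 = 0 := rfl
      simp only [RCLike.inner_apply, tridiagAct, hg_zero]
      ring
    | succ k =>
      simp only [RCLike.inner_apply, tridiagAct, g, map_mul, conj_conj]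
      ring
  have hsum := hdiag.hasSum.add (hupper.hasSum.add hg)
  simp only [← hrows] at hsum
  rw [(lp.hasSum_inner x (tridiagOp ha hb hc x)).unique hsum]
  simpa only [ellipticMap_apply] using hdiag.hasSum.add (hupper.hasSum.add hlower.hasSum)

theorem hasSum_inner_tridiagOp_of_diag_eq_zero (hb_zero : ∀ k, b k = 0) (x : Ell2) :
    HasSum (fun k => ellipticMap (c k) (a (k + 1)) (conj (x k) * x (k + 1)))
      (inner ℂ x (tridiagOp ha hb hc x)) := by
  simpa only [hb_zero, zero_mul, zero_add] using hasSum_inner_tridiagOp ha hb hc x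

theorem smul_sum_mem_numericalRange_tridiagOp (hb_zero : ∀ k, b k = 0) {s : ℕ → ℂ}
    (hs : ∀ k, ‖s k‖ = 1) (N : ℕ) :
    ((N : ℝ) + 1)⁻¹ • ∑ k ∈ Finset.range N, ellipticMap (c k) (a (k + 1)) (s k) ∈
      numericalRange (tridiagOp ha hb hc) := by
  obtain ⟨x, hx, hxs⟩ := exists_norm_eq_one_conj_mul_succ_eq hs N
  refine ⟨x, hx, (hasSum_inner_tridiagOp_of_diag_eq_zero ha hb hc hb_zero x).unique ?_⟩
  have hsupp (k : ℕ) (hk : k ∉ Finset.range N) :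
      ellipticMap (c k) (a (k + 1)) (conj (x k) * x (k + 1)) = 0 := by
    rw [hxs, if_neg (Finset.mem_range.not.1 hk), map_zero]
  convert hasSum_sum_of_ne_finset_zero (L := .unconditional ℕ) hsupp using 1
  rw [Finset.smul_sum]
  refine Finset.sum_congr rfl fun k hk => ?_
  rw [hxs, if_pos (Finset.mem_range.1 hk), map_smul]

theorem average_mem_closure_numericalRange_tridiagOp (hb_zero : ∀ k, b k = 0) {s : ℕ → ℂ}
    (hs : ∀ k, ‖s k‖ = 1) {m : ℕ} (hm : m ≠ 0)
    (hper : Function.Periodic (fun k => ellipticMap (c k) (a (k + 1)) (s k)) m) :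
    (m : ℝ)⁻¹ • ∑ k ∈ Finset.range m, ellipticMap (c k) (a (k + 1)) (s k) ∈
      closure (numericalRange (tridiagOp ha hb hc)) := by
  set w := ∑ k ∈ Finset.range m, ellipticMap (c k) (a (k + 1)) (s k)
  have hlim : Tendsto (fun N : ℕ => (((N * m : ℕ) : ℝ) + 1)⁻¹ * N) atTop (𝓝 (m : ℝ)⁻¹) := by
    have h := ((tendsto_natCast_div_add_atTop (1 : ℝ)).comp
      (tendsto_id.atTop_mul_const' (Nat.pos_of_ne_zero hm))).const_mul (m : ℝ)⁻¹
    rw [mul_one] at h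
    refine h.congr fun N => ?_
    have : (m : ℝ) ≠ 0 := Nat.cast_ne_zero.2 hm
    simp only [Function.comp_apply, id_eq, Nat.cast_mul]
    field_simp
  refine mem_closure_of_tendsto (hlim.smul_const w) (Eventually.of_forall fun N => ?_)
  have h := smul_sum_mem_numericalRange_tridiagOp ha hb hc hb_zero hs (N * m)
  rwa [sum_range_mul_of_periodic hper, ← Nat.cast_smul_eq_nsmul ℝ, smul_smul] at h

end TridiagonalForm

theorem numericalRange_tridiagOp_subset {a b c : ℕ → ℂ} (ha : Function.Periodic a 2)
    (hb : Function.Periodic b 2) (hc : Function.Periodic c 2) (hb_zero : ∀ k, b k = 0) :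
    numericalRange (tridiagOp (n := 1) ha hb hc) ⊆
      ellipticDisc (c 0) (a 1) + ellipticDisc (c 1) (a 0) := by
  rintro _ ⟨x, hx, rfl⟩
  have hpairs (d : ℕ) : (Sum.elim (fun k => 2 * k + d) (fun k => 2 * k + d + 1)).Injective :=
    .sumElim (fun _ _ _ => by lia) (fun _ _ _ => by lia) fun _ _ => by lia
  have heven : (Sum.elim (fun k => 2 * k) (fun k => 2 * k + 1)).Injective := hpairs 0
  have hodd : (Sum.elim (fun k => 2 * k + 1) (fun k => 2 * k + 1 + 1)).Injective := hpairs 1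
  have hsum {i j : ℕ → ℕ} (hij : (Sum.elim i j).Injective) (c a : ℂ) :
      HasSum (fun k => ellipticMap c a (conj (x (i k)) * x (j k)))
        (ellipticMap c a (∑' k, conj (x (i k)) * x (j k))) :=
    (ellipticMap c a).hasSum (summable_norm_conj_mul x (hij.comp Sum.inl_injective)
      (hij.comp Sum.inr_injective)).of_norm.hasSum
  have hinner : inner ℂ x (tridiagOp (n := 1) ha hb hc x) =
      ellipticMap (c 0) (a 1) (∑' k, conj (x (2 * k)) * x (2 * k + 1)) +
      ellipticMap (c 1) (a 0) (∑' k, conj (x (2 * k + 1)) * x (2 * k + 1 + 1)) := by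
    refine (hasSum_inner_tridiagOp_of_diag_eq_zero ha hb hc hb_zero x).unique
      (HasSum.even_add_odd ?_ ?_)
    · convert hsum heven (c 0) (a 1) using 4 with k
      exacts [apply_two_mul_add hc k 0, apply_two_mul_add ha k 1]
    · convert hsum hodd (c 1) (a 0) using 4 with k
      exacts [apply_two_mul_add hc k 1, (apply_two_mul_add ha k 2).trans (ha 0)]
  rw [hinner]
  apply Set.add_mem_add <;> apply ellipticMap_mem_ellipticDisc
  · simpa [hx] using norm_tsum_conj_mul_le x heven
  · simpa [hx] using norm_tsum_conj_mul_le x hodd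

theorem ellipticDisc_add_subset_closure {a b c : ℕ → ℂ} (ha : Function.Periodic a 2)
    (hb : Function.Periodic b 2) (hc : Function.Periodic c 2) (hb_zero : ∀ k, b k = 0) :
    ellipticDisc (c 0) (a 1) + ellipticDisc (c 1) (a 0) ⊆
      closure (numericalRange (tridiagOp (n := 1) ha hb hc)) := by
  rintro _ ⟨_, ⟨p, hp, rfl⟩, _, ⟨q, hq, rfl⟩, rfl⟩
  have hfour {p : ℂ} (hp : p ∈ closedBall 0 (1 / 2)) : ‖(4 : ℝ) • p‖ ≤ 2 * 1 := by
    rw [norm_smul, Real.norm_ofNat]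
    linarith [mem_closedBall_zero_iff.1 hp]
  obtain ⟨ζ₀, η₀, hζ₀, hη₀, hp⟩ := exists_norm_eq_add_eq (hfour hp)
  obtain ⟨ζ₁, η₁, hζ₁, hη₁, hq⟩ := exists_norm_eq_add_eq (hfour hq)
  let s : ℕ → ℂ := fun k => ![ζ₀, ζ₁, η₀, η₁] (Fin.ofNat 4 k)
  have hs (k : ℕ) : ‖s k‖ = 1 := by
    have h : ∀ i, ‖![ζ₀, ζ₁, η₀, η₁] i‖ = 1 := by simp [Fin.forall_fin_succ, *]
    exact h _
  have hper : Function.Periodic (fun k => ellipticMap (c k) (a (k + 1)) (s k)) 4 := fun k => by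
    have ha4 : Function.Periodic a 4 := ha.nat_mul 2
    have hc4 : Function.Periodic c 4 := hc.nat_mul 2
    have hs4 : s (k + 4) = s k := congrArg ![ζ₀, ζ₁, η₀, η₁] (Fin.ext (Nat.add_mod_right k 4))
    simp only [hs4, add_right_comm k 4 1, hc4 k, ha4 (k + 1)]
  convert average_mem_closure_numericalRange_tridiagOp (n := 1) ha hb hc hb_zero hs four_ne_zero
    hper using 1
  have hsum : ∑ k ∈ Finset.range 4, ellipticMap (c k) (a (k + 1)) (s k) =
      ellipticMap (c 0) (a 1) (ζ₀ + η₀) + ellipticMap (c 1) (a 0) (ζ₁ + η₁) := by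
    have ha2 : a 2 = a 0 := ha 0
    have ha3 : a 3 = a 1 := ha 1
    have ha4 : a 4 = a 0 := ha.nat_mul_eq 2
    have hc2 : c 2 = c 0 := hc 0
    have hc3 : c 3 = c 1 := hc 1
    simp only [Finset.sum_range_succ, Finset.sum_range_zero, zero_add, Nat.reduceAdd, ha2, ha3,
      ha4, hc2, hc3, map_add]
    change ellipticMap (c 0) (a 1) ζ₀ + ellipticMap (c 1) (a 0) ζ₁ + ellipticMap (c 0) (a 1) η₀ +
      ellipticMap (c 1) (a 0) η₁ = _
    ring
  rw [hsum, hp, hq, map_smul, map_smul, ← smul_add, Nat.cast_ofNat, inv_smul_smul₀ four_ne_zero]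

end Operator

/-- Omitting the conjugates of `alphaCoeff` and `gammaCoeff` is what makes the formula correct for
complex sequences: the two blocks of `S` must see the pairs `(c₀, a₁)` and `(c₁, a₀)` themselves. -/
theorem proposition2p7_general (a b c : ℕ → ℂ) (ha : Function.Periodic a 2)
    (hb : Function.Periodic b 2) (hc : Function.Periodic c 2) (hb_zero : ∀ k, b k = 0) :
    closure (numericalRange (tridiagOp (n := 1) ha hb hc)) =
      matrixNumericalRange (matrixS ((c 0 + a 1) / 2) ((a 0 + c 1) / 2)
        ((c 0 - a 1) / (2 * I)) ((a 0 - c 1) / (2 * I))) := by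
  have hadd (u v : ℂ) : (u + v) / 2 + I * ((u - v) / (2 * I)) = u := by
    field_simp
    ring
  have hsub (u v : ℂ) : (u + v) / 2 - I * ((u - v) / (2 * I)) = v := by
    field_simp
    ring
  rw [matrixNumericalRange_matrixS, hadd, hsub, hadd, hsub, ellipticDisc_comm (a 0)]
  have hclosed := ((isCompact_ellipticDisc (c 0) (a 1)).add
    (isCompact_ellipticDisc (c 1) (a 0))).isClosed
  exact (closure_minimal (numericalRange_tridiagOp_subset ha hb hc hb_zero) hclosed).antisymm
    (ellipticDisc_add_subset_closure ha hb hc hb_zero)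

theorem proposition2p7 (a b c : ℕ → ℂ)
    (ha : Function.Periodic a 2) (hb : Function.Periodic b 2)
    (hc : Function.Periodic c 2)
    (ha_real : ∀ k, (a k).im = 0) (hc_real : ∀ k, (c k).im = 0) (hb_zero : ∀ k, b k = 0) :
    closure (numericalRange (tridiagOp (n := 1) ha hb hc)) =
      matrixNumericalRange (matrixS (alphaCoeff 1 a c 0) (alphaCoeff 1 a c 1)
        (gammaCoeff 1 a c 0) (gammaCoeff 1 a c 1)) := by
  simpa [alphaCoeff, gammaCoeff, conj_eq_iff_im.2 (ha_real 1), conj_eq_iff_im.2 (hc_real 1)]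
    using proposition2p7_general a b c ha hb hc hb_zero
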